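/- Let $F$ be a field of characteristic $0$, let $V$ be a finite-dimensional $F$-vector space, and let $n,k\ge 0$. Let $S_m$ act on $V^{\otimes m}$ by $\sigma(v_1\otimes\cdots\otimes v_m)=v_{\sigma^{-1}(1)}\otimes\cdots\otimes v_{\sigma^{-1}(m)}$, and identify $\mathrm{End}(V)^{\otimes m}=\mathrm{End}(V^{\otimes m})$ canonically. Let $\mathcal T^{n}(k)$ be the space of multilinear maps $H:\mathrm{End}(V)^k\to \mathrm{End}(V)^{\otimes n}$ that are equivariant for the conjugation actions of $GL(V)$, and let $\mathrm{End}_{GL(V)}(V^{\otimes (n+k)})$ be the algebra of operators commuting with the diagonal action of $GL(V)$. 1. There is exactly one linear isomorphism $\Phi:\mathcal T^{n}(k)\to \mathrm{End}_{GL(V)}(V^{\otimes(n+k)})$ such that, for all $H\in\mathcal T^n(k)$ and $x_1,\dots,x_k,y_1,\dots,y_n\in \mathrm{End}(V)$, $$\mathrm{tr}\big(H(x_1,\dots,x_k)\circ y_1\otimes\cdots\otimes y_n\big)=\mathrm{tr}\big(\Phi(H)\circ y_1\otimes\cdots\otimes y_n\otimes x_1\otimes\cdots\otimes x_k\big).$$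 2. Put $A=\{1,\dots,n\}$ and $B=\{n+1,\dots,n+k\}$. Every $\tau\in S_{n+k}$ can be written in exactly one way as $\tau=\tau_1\tau_2\tau_3$ (its splitting), where each nontrivial cycle of $\tau_1$ contains exactly one element of $A$, where $\tau_2\in S_B$ is the product of the cycles of $\tau$ contained in $B$, and where $\tau_3\in S_A$. 3. For every $\tau\in S_{n+k}$ there is exactly one multilinear map $T^{(n)}_{k,\tau}:\mathrm{End}(V)^k\to\mathrm{End}(V)^{\otimes n}$ (the interpretation of $\tau$) such that, for all $x_i,y_j\in\mathrm{End}(V)$, $$\mathrm{tr}\big(T^{(n)}_{k,\tau}(x_1,\dots,x_k)\circ y_1\otimes\cdots\otimes y_n\big)=\mathrm{tr}\big(\tau^{-1}\circ y_1\otimes\cdots\otimes y_n\otimes x_1\otimes\cdots\otimes x_k\big).$$ If $\tau=\tau_1\tau_2\tau_3$ is the splitting of $\tau$, then $$T^{(n)}_{k,\tau}(x_1,\dots,x_k)=\tau_3^{-1}\circ\Big(\prod_{\ell}\mathrm{tr}(N_\ell)\Big)\,M_1\otimes\cdots\otimes M_n .$$ Here the product is over the cycles $(n+j_1,\dots,n+j_p)$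 of $\tau$ contained in $B$ (fixed points included), with $N_\ell=x_{j_1}\cdots x_{j_p}$ for the $\ell$-th such cycle, and $M_i=x_{f_1}\cdots x_{f_p}$ where $(i,n+f_1,\dots,n+f_p)$ is the cycle of $\tau_1$ through $i$ (so $M_i=1$ if $\tau_1(i)=i$). 4. The maps $T^{(n)}_{k,\tau}$, $\tau\in S_{n+k}$, span the space $\mathcal T^{n}(k)$ linearly. -/

import Mathlib

open scoped TensorProduct

section Permutations

variable {n k : ℕ}

/-- A permutation of `A = {1, …, n}`, seen as a permutation of `{1, …, n + k}` fixing the last `k`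
indices. -/
def permOfA (k : ℕ) (σ : Equiv.Perm (Fin n)) : Equiv.Perm (Fin (n + k)) :=
  finSumFinEquiv.permCongr (Equiv.Perm.sumCongr σ (1 : Equiv.Perm (Fin k)))

/-- A permutation of `B = {n + 1, …, n + k}` (identified with `{1, …, k}`), seen as a permutation of
`{1, …, n + k}` fixing the first `n` indices. -/
def permOfB (n : ℕ) (σ : Equiv.Perm (Fin k)) : Equiv.Perm (Fin (n + k)) :=
  finSumFinEquiv.permCongr (Equiv.Perm.sumCongr (1 : Equiv.Perm (Fin n)) σ)

/-- The cycle of `τ` through the index `n + b` consists only of elements of `B`.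
This includes the case where `n + b` is a fixed point of `τ`. -/
def CycleInB (τ : Equiv.Perm (Fin (n + k))) (b : Fin k) : Prop :=
  ∀ a : Fin n, ¬ τ.SameCycle (Fin.natAdd n b) (Fin.castAdd k a)

/-- `τ = τ₁ τ₂ τ₃` is the splitting of `τ` relative to `{1, …, n + k} = A ∪ B`. -/
structure IsSplitting (τ τ₁ : Equiv.Perm (Fin (n + k))) (τ₂ : Equiv.Perm (Fin k))
    (τ₃ : Equiv.Perm (Fin n)) : Prop where
  /-- The product decomposition; `τ₂ ∈ S_B` and `τ₃ ∈ S_A` by their types. -/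
  mul_eq : τ = τ₁ * permOfB n τ₂ * permOfA k τ₃
  /-- Each nontrivial cycle of `τ₁` contains exactly one element of `A`. -/
  cycle_one : ∀ i, τ₁ i ≠ i → ∃! a : Fin n, τ₁.SameCycle i (Fin.castAdd k a)
  /-- On the cycles of `τ` contained in `B`, `τ₂` agrees with `τ`. -/
  two_of_inB : ∀ b, CycleInB τ b → Fin.natAdd n (τ₂ b) = τ (Fin.natAdd n b)
  /-- All other indices are fixed by `τ₂`. -/
  two_of_not_inB : ∀ b, ¬ CycleInB τ b → τ₂ b = b

/-- The cycle `(i, σ i, σ² i, …)` of `σ` through `i`, written as a list starting at `i`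
(equal to `[i]` if `i` is a fixed point). -/
noncomputable def cycleList {α : Type*} (σ : Equiv.Perm α) (i : α) : List α :=
  List.iterate σ i (Function.minimalPeriod σ i)

end Permutations

section Tensors

variable (F : Type*) [Field F] (V : Type*) [AddCommGroup V] [Module F V]

/-- The canonical map `End(V)^{⊗ m} → End(V^{⊗ m})`, given by
`(a₁ ⊗ ⋯ ⊗ aₘ)(v₁ ⊗ ⋯ ⊗ vₘ) = a₁ v₁ ⊗ ⋯ ⊗ aₘ vₘ`. -/
noncomputable def tensorEnd (m : ℕ) :
    (⨂[F] _ : Fin m, Module.End F V) →ₗ[F] Module.End F (⨂[F] _ : Fin m, V) :=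
  PiTensorProduct.piTensorHomMap

/-- The action of `σ ∈ S_m` on `V^{⊗ m}`:
`σ (v₁ ⊗ ⋯ ⊗ vₘ) = v_{σ⁻¹(1)} ⊗ ⋯ ⊗ v_{σ⁻¹(m)}`. -/
noncomputable def permTensor {m : ℕ} (σ : Equiv.Perm (Fin m)) :
    Module.End F (⨂[F] _ : Fin m, V) :=
  (PiTensorProduct.reindex F (fun _ : Fin m => V) σ).toLinearMap

/-- `End_{GL(V)}(V^{⊗ m})`: the operators commuting with the diagonal action of `GL(V)`. -/
noncomputable def glEnd (m : ℕ) : Subalgebra F (Module.End F (⨂[F] _ : Fin m, V)) :=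
  Subalgebra.centralizer F
    (Set.range fun g : V ≃ₗ[F] V => PiTensorProduct.map fun _ : Fin m => g.toLinearMap)

/-- The multilinear maps from `k` endomorphisms to `End(V)^{⊗ n}`, equivariant for the action of
`GL(V)` by (simultaneous) conjugation `a ↦ g a g⁻¹`. -/
noncomputable def equivariantMaps (n k : ℕ) :
    Submodule F (MultilinearMap F (fun _ : Fin k => Module.End F V)
      (⨂[F] _ : Fin n, Module.End F V)) where
  carrier := {H | ∀ (g : V ≃ₗ[F] V) (x : Fin k → Module.End F V),
    H (fun i => g.conj (x i)) =
      PiTensorProduct.map (fun _ : Fin n => g.conj.toLinearMap) (H x)}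
  add_mem' := by
    intro H K hH hK g x
    simp only [add_apply, map_add, hH g x, hK g x]
  zero_mem' := by
    intro g x
    simp only [zero_apply, map_zero]
  smul_mem' := by
    intro c H hH g x
    simp only [smul_apply, map_smul, hH g x]

variable {F V} {n k : ℕ}

/-- `H` is the interpretation `T^{(n)}_{k,τ}` of `τ ∈ S_{n+k}`:
`tr(H(x) ∘ y₁ ⊗ ⋯ ⊗ yₙ) = tr(τ⁻¹ ∘ y₁ ⊗ ⋯ ⊗ yₙ ⊗ x₁ ⊗ ⋯ ⊗ xₖ)` for all `x`, `y`. -/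
def IsInterpretation (τ : Equiv.Perm (Fin (n + k)))
    (H : MultilinearMap F (fun _ : Fin k => Module.End F V)
      (⨂[F] _ : Fin n, Module.End F V)) : Prop :=
  ∀ (x : Fin k → Module.End F V) (y : Fin n → Module.End F V),
    LinearMap.trace F (⨂[F] _ : Fin n, V) (tensorEnd F V n (H x) * PiTensorProduct.map y) =
      LinearMap.trace F (⨂[F] _ : Fin (n + k), V)
        (permTensor F V τ⁻¹ * PiTensorProduct.map (Fin.append y x))

/-- The monomial `M_a = x_{f₁} x_{f₂} ⋯ x_{f_p}` of the cycle `(a, n + f₁, …, n + f_p)` of `τ₁`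
through `a ∈ A`. (When `τ₁` is the first factor of a splitting, the tail of the cycle lies in `B`,
so that the value `1` given to the indices in `A` is never used.) -/
noncomputable def cycleMonomial (τ₁ : Equiv.Perm (Fin (n + k))) (x : Fin k → Module.End F V)
    (a : Fin n) : Module.End F V :=
  ((cycleList τ₁ (Fin.castAdd k a)).tail.map (Fin.append (fun _ : Fin n => 1) x)).prod

open Classical in
/-- `t_{τ₂}(x) = ∏ tr(x_{j₁} x_{j₂} ⋯ x_{j_ℓ})`, the product over all the cycles
`(n + j₁, …, n + j_ℓ)` of `τ` contained in `B` (fixed points included), which are the cycles that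
form `τ₂`. Each cycle is listed from its least element; by cyclic invariance of the trace, the
starting point does not matter. -/
noncomputable def cycleTraces (τ : Equiv.Perm (Fin (n + k))) (τ₂ : Equiv.Perm (Fin k))
    (x : Fin k → Module.End F V) : F :=
  ∏ b : Fin k with CycleInB τ b ∧ ∀ b', τ₂.SameCycle b b' → b ≤ b',
    LinearMap.trace F V ((cycleList τ₂ b).map x).prod

end Tensors

/-! The trace form on `End(V^{⊗m})` is nondegenerate, and the operators `z₁ ⊗ ⋯ ⊗ zₘ` span
(`eq_of_trace_mul_map_eq`). So operators on `V^{⊗m}` are the same as multilinear forms on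
`End(V)^m`. Currying such a form on `n + k` arguments gives `exists_linearEquiv_traceDual`, a
bijection between all multilinear maps `H` and all operators on `V^{⊗(n+k)}`. Uniqueness of the
partner makes it compatible with conjugation, so equivariant maps match `End_{GL(V)}`
(`TraceDual.mem_equivariantMaps_iff`), and the interpretation of `τ` is the partner of `τ⁻¹`.

Spanning is then the first fundamental theorem, `span_range_permTensor`. An operator commuting with
`GL(V)` commutes with every `u ⊗ ⋯ ⊗ u` by a polynomial argument; by polarization these span the
centralizer of `Sₘ`; and the double centralizer property, proved by averaging, puts the operator in
the span of `Sₘ`.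

For the splitting, `τ₃` is the first-return map of `τ` on `A`, `τ₂` is `τ` on its cycles inside `B`,
and `τ₁` is what remains: each excursion from `A` through `B` closed up into a cycle
(`pow_succ_eq_of_forall_ne`).

The explicit formula is checked on rank one operators, where the trace is a product of pairings
`φᵢ(v_{τ i})`. Multiplying the operators along a segment of a cycle contracts the inner pairings,
leaving `τ₃` on the excursions and a trace for each cycle in `B` (`trace_permTensor_mul_map_eq`). -/

open Module in
theorem span_range_smulRight {F W : Type*} [Field F] [AddCommGroup W] [Module F W]
    [FiniteDimensional F W] :
    Submodule.span F (Set.range fun p : W × Dual F W => p.2.smulRight p.1) =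
      (⊤ : Submodule F (End F W)) := by
  refine eq_top_iff.2 fun f _ => ?_
  let b := finBasis F W
  have hf : f = ∑ i, (b.coord i).smulRight (f (b i)) := by
    refine b.ext fun j => ?_
    simp [LinearMap.sum_apply, Finsupp.single_apply, ite_smul]
  rw [hf]
  exact Submodule.sum_mem _ fun i _ => Submodule.subset_span ⟨(f (b i), b.coord i), rfl⟩

/-! ### Nondegeneracy of the trace form. -/

section TraceForm

open Module

variable {F W : Type*} [Field F] [AddCommGroup W] [Module F W] [FiniteDimensional F W]

theorem trace_mul_smulRight (f : End F W) (φ : Dual F W) (w : W) :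
    LinearMap.trace F W (f * φ.smulRight w) = φ (f w) := by
  rw [show f * φ.smulRight w = φ.smulRight (f w) by ext; simp, LinearMap.trace_smulRight]

theorem eq_of_trace_mul_eq {f g : End F W}
    (h : ∀ a, LinearMap.trace F W (f * a) = LinearMap.trace F W (g * a)) : f = g := by
  ext w
  rw [← sub_eq_zero, ← forall_dual_apply_eq_zero_iff F]
  intro φ
  have := h (φ.smulRight w)
  rw [trace_mul_smulRight, trace_mul_smulRight] at this
  rw [map_sub, this, sub_self]

end TraceForm

/-! ### Permutations and pure tensors in `End(V^{⊗m})`. -/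

section TensorPowers

open Module

variable {F : Type*} [Field F] {V : Type*} [AddCommGroup V] [Module F V] {m : ℕ}

theorem permTensor_tprod (σ : Equiv.Perm (Fin m)) (v : Fin m → V) :
    permTensor F V σ (PiTensorProduct.tprod F v) = PiTensorProduct.tprod F fun i => v (σ⁻¹ i) := by
  simp [permTensor, Equiv.Perm.inv_def]

/-- The action of the symmetric group on tensor powers, as a homomorphism of monoids. -/
noncomputable def permTensorHom (F : Type*) [Field F] (V : Type*) [AddCommGroup V] [Module F V]
    (m : ℕ) : Equiv.Perm (Fin m) →* End F (⨂[F] _ : Fin m, V) where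
  toFun := permTensor F V
  map_one' := by
    refine PiTensorProduct.ext (MultilinearMap.ext fun v => ?_)
    simp [permTensor_tprod]
  map_mul' σ ρ := by
    refine PiTensorProduct.ext (MultilinearMap.ext fun v => ?_)
    simp [permTensor_tprod]

theorem permTensor_mul_map (σ : Equiv.Perm (Fin m)) (z : Fin m → End F V) :
    permTensor F V σ * PiTensorProduct.map z =
      PiTensorProduct.map (fun i => z (σ⁻¹ i)) * permTensor F V σ := by
  refine PiTensorProduct.ext (MultilinearMap.ext fun v => ?_)
  simp [permTensor_tprod]

theorem tensorEnd_tprod (z : Fin m → End F V) :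
    tensorEnd F V m (PiTensorProduct.tprod F z) = PiTensorProduct.map z :=
  PiTensorProduct.piTensorHomMap_tprod_eq_map z

theorem permTensor_mem_glEnd (σ : Equiv.Perm (Fin m)) : permTensor F V σ ∈ glEnd F V m := by
  refine (Subalgebra.mem_centralizer_iff F).2 ?_
  rintro _ ⟨g, rfl⟩
  exact (permTensor_mul_map σ fun _ => g.toLinearMap).symm

variable [FiniteDimensional F V]

/-- A rank one operator built from a pure tensor and a product of coordinate forms is itself a
tensor product of rank one operators, and such operators span. -/
theorem span_range_map :
    Submodule.span F (Set.range fun z : Fin m → End F V => PiTensorProduct.map z) =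
      (⊤ : Submodule F (End F (⨂[F] _ : Fin m, V))) := by
  refine eq_top_iff.2 fun f _ => ?_
  let b := finBasis F V
  let B := Basis.piTensorProduct fun _ : Fin m => b
  have hf : f = ∑ p, (B.coord p).smulRight (f (B p)) := by
    refine B.ext fun j => ?_
    simp [LinearMap.sum_apply, -Basis.piTensorProduct_apply, Finsupp.single_apply, ite_smul]
  rw [hf]
  refine Submodule.sum_mem _ fun p _ => ?_
  have hx : f (B p) ∈ Submodule.span F (Set.range (PiTensorProduct.tprod F)) := by
    rw [PiTensorProduct.span_tprod_eq_top]; trivial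
  generalize f (B p) = y at hx
  induction hx using Submodule.span_induction with
  | mem x hx =>
    obtain ⟨v, rfl⟩ := hx
    refine Submodule.subset_span ⟨fun i => (b.coord (p i)).smulRight (v i), ?_⟩
    refine PiTensorProduct.ext (MultilinearMap.ext fun w => ?_)
    simp [B, MultilinearMap.map_smul_univ]
  | zero => simp
  | add x y _ _ hx hy =>
    rw [show (B.coord p).smulRight (x + y) = (B.coord p).smulRight x + (B.coord p).smulRight y by
      ext; simp]
    exact Submodule.add_mem _ hx hy
  | smul c x _ hx =>
    rw [show (B.coord p).smulRight (c • x) = c • (B.coord p).smulRight x by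
      ext; simp [smul_comm c]]
    exact Submodule.smul_mem _ c hx

/-- The image contains the spanning set of pure tensors, and both sides have dimension `(dim
V)^{2m}`. -/
theorem tensorEnd_bijective : Function.Bijective (tensorEnd F V m) := by
  have hs : Function.Surjective (tensorEnd F V m) := by
    rw [← LinearMap.range_eq_top, eq_top_iff, ← span_range_map, Submodule.span_le]
    rintro _ ⟨z, rfl⟩
    exact ⟨PiTensorProduct.tprod F z, tensorEnd_tprod z⟩
  refine ⟨(LinearMap.injective_iff_surjective_of_finrank_eq_finrank ?_).2 hs, hs⟩
  let b := finBasis F V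
  rw [finrank_eq_card_basis (Basis.piTensorProduct fun _ : Fin m => b.end), finrank_linearMap,
    finrank_eq_card_basis (Basis.piTensorProduct fun _ : Fin m => b)]
  simp [mul_pow]

theorem eq_of_trace_mul_map_eq {f g : End F (⨂[F] _ : Fin m, V)}
    (h : ∀ z : Fin m → End F V, LinearMap.trace F _ (f * PiTensorProduct.map z) =
      LinearMap.trace F _ (g * PiTensorProduct.map z)) : f = g := by
  refine eq_of_trace_mul_eq fun a => ?_
  have ha : a ∈ Submodule.span F (Set.range fun z : Fin m → End F V => PiTensorProduct.map z) := by
    rw [span_range_map]; trivial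
  induction ha using Submodule.span_induction with
  | mem x hx => obtain ⟨z, rfl⟩ := hx; exact h z
  | zero => simp
  | add x y _ _ hx hy => simp only [mul_add, map_add, hx, hy]
  | smul c x _ hx => simp only [mul_smul_comm, map_smul, hx]

/-- The trace of a permutation composed with a tensor product of rank one operators. -/
theorem trace_permTensor_mul_map_smulRight (σ : Equiv.Perm (Fin m)) (v : Fin m → V)
    (φ : Fin m → Dual F V) :
    LinearMap.trace F _ (permTensor F V σ⁻¹ *
      PiTensorProduct.map fun i => (φ i).smulRight (v i)) = ∏ i, φ i (v (σ i)) := by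
  have : (PiTensorProduct.map fun i => (φ i).smulRight (v i)) =
      (PiTensorProduct.dualDistrib (PiTensorProduct.tprod F φ)).smulRight
        (PiTensorProduct.tprod F v) := by
    refine PiTensorProduct.ext (MultilinearMap.ext fun w => ?_)
    simp [MultilinearMap.map_smul_univ]
  rw [this, trace_mul_smulRight, permTensor_tprod]
  simp

end TensorPowers

/-! ### The double centralizer property for finite groups. -/

section DoubleCentralizer

open Module

variable {F W : Type*} [Field F] [CharZero F] [AddCommGroup W] [Module F W] [FiniteDimensional F W]

/-- The double centralizer property for a representation of a finite group in characteristic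
zero. -/
theorem mem_span_range_of_commute_centralizer {G : Type*} [Group G] [Fintype G]
    (ρ : G →* End F W) (f : End F W)
    (hf : ∀ a : End F W, (∀ g, Commute (ρ g) a) → Commute f a) :
    f ∈ Submodule.span F (Set.range ρ) := by
  set B := Submodule.span F (Set.range ρ) with hB
  have hmul : ∀ g, ∀ b ∈ B, ρ g * b ∈ B := by
    intro g b hb
    induction hb using Submodule.span_induction with
    | mem x hx =>
      obtain ⟨h, rfl⟩ := hx
      exact Submodule.subset_span ⟨g * h, map_mul ρ g h⟩
    | zero => simp
    | add x y _ _ hx hy => rw [mul_add]; exact B.add_mem hx hy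
    | smul c x _ hx => rw [mul_smul_comm]; exact B.smul_mem c hx
  obtain ⟨q, hq⟩ := LinearMap.exists_leftInverse_of_injective B.subtype B.ker_subtype
  have hqB : ∀ b ∈ B, (q b : End F W) = b := fun b hb =>
    congrArg Subtype.val (LinearMap.congr_fun hq ⟨b, hb⟩)
  -- Unnormalized Maschke averaging of the linear projection `q` onto `B`: `p` commutes with left
  -- multiplication by each `ρ h`, lands in `B`, and multiplies `1` by `|G|`.
  let p : End F W → End F W := fun X => ∑ g, ρ g * q (ρ g⁻¹ * X)
  have hp_mul : ∀ h X, p (ρ h * X) = ρ h * p X := by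
    intro h X
    simp only [p, Finset.mul_sum]
    refine Fintype.sum_equiv (Equiv.mulLeft h⁻¹) _ _ fun g => ?_
    simp [← mul_assoc, ← map_mul]
  have hp_add : ∀ X Y, p (X + Y) = p X + p Y := by
    intro X Y
    simp [p, mul_add, Finset.sum_add_distrib]
  have hp_smul : ∀ (c : F) X, p (c • X) = c • p X := by
    intro c X
    simp [p, Finset.smul_sum]
  have hp_one : p 1 = (Fintype.card G : F) • (1 : End F W) := by
    have : ∀ g, ρ g * (q (ρ g⁻¹ * 1) : End F W) = 1 := by
      intro g
      rw [mul_one, hqB _ (Submodule.subset_span ⟨g⁻¹, rfl⟩), ← map_mul, mul_inv_cancel, map_one]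
    simp only [p, this, Finset.sum_const, Finset.card_univ, Nat.cast_smul_eq_nsmul]
  have hp_mem : ∀ X, p X ∈ B := fun X => B.sum_mem fun g _ => hmul g _ (q _).2
  have hcomm : ∀ X, f * p X = p (f * X) := by
    intro X
    have hX : X ∈ Submodule.span F (Set.range fun p : W × Dual F W => p.2.smulRight p.1) := by
      rw [span_range_smulRight]; trivial
    induction hX using Submodule.span_induction with
    | mem x hx =>
      obtain ⟨⟨v, ξ⟩, rfl⟩ := hx
      have hS : ∀ (a : End F W) (u : W), ξ.smulRight (a u) = a * ξ.smulRight u := by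
        intro a u; ext; simp
      ext w
      -- For fixed `ξ` and `w`, sending `u` to `p (ξ ⊗ u) w` is an operator commuting with `G`,
      -- hence with `f`. Evaluating at `v` gives the claim for the rank one operator `ξ ⊗ v`.
      let a : End F W :=
        { toFun := fun u => p (ξ.smulRight u) w
          map_add' := fun u u' => by
            rw [show ξ.smulRight (u + u') = ξ.smulRight u + ξ.smulRight u' by ext; simp, hp_add]
            simp
          map_smul' := fun c u => by
            rw [show ξ.smulRight (c • u) = c • ξ.smulRight u by ext; simp [smul_comm c], hp_smul]
            simp }
      have ha : Commute f a := hf a fun g => by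
        ext u
        change ρ g (p (ξ.smulRight u) w) = p (ξ.smulRight (ρ g u)) w
        rw [hS, hp_mul]
        rfl
      have := LinearMap.congr_fun ha.eq v
      change f (p (ξ.smulRight v) w) = p (ξ.smulRight (f v)) w at this
      rw [hS] at this
      exact this
    | zero =>
      have h0 : p 0 = 0 := by simpa using hp_smul 0 0
      simp [h0]
    | add x y _ _ hx hy => rw [hp_add, mul_add, mul_add, hp_add, hx, hy]
    | smul c x _ hx => rw [hp_smul, mul_smul_comm, mul_smul_comm, hp_smul, hx]
  have h1 := hcomm 1
  rw [hp_one, mul_smul_comm, mul_one] at h1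
  have hc : (Fintype.card G : F) ≠ 0 := Nat.cast_ne_zero.2 Fintype.card_ne_zero
  rw [← inv_smul_smul₀ hc f, h1]
  exact B.smul_mem _ (hp_mem _)

end DoubleCentralizer

/-! ### Polarization. -/

section Polarization

/-- The polarization identity for symmetrized multilinear maps. -/
theorem MultilinearMap.sum_perm_eq_sum_neg_one_pow {R M N : Type*} [CommRing R] [AddCommGroup M]
    [Module R M] [AddCommGroup N] [Module R N] {ι : Type*} [Fintype ι] [DecidableEq ι]
    (f : MultilinearMap R (fun _ : ι => M) N) (z : ι → M) :
    ∑ σ : Equiv.Perm ι, f (fun i => z (σ i)) =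
      ∑ U : Finset ι, (-1 : ℤ) ^ U.card • f fun _ => ∑ j ∈ Uᶜ, z j := by
  have h1 : ∀ U : Finset ι, (f fun _ => ∑ j ∈ Uᶜ, z j) =
      ∑ r : ι → ι, if U ⊆ (Finset.univ.image r)ᶜ then f (fun i => z (r i)) else 0 := by
    intro U
    rw [f.map_sum_finset (fun _ j => z j) fun _ => Uᶜ, ← Finset.sum_filter]
    refine Finset.sum_congr ?_ fun _ _ => rfl
    ext r
    simp only [Fintype.mem_piFinset, Finset.mem_compl, Finset.mem_filter_univ, Finset.subset_iff,
      Finset.mem_image, Finset.mem_univ, true_and, not_exists]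
    exact ⟨fun h j hj i hi => h i (hi ▸ hj), fun h i hi => h hi i rfl⟩
  -- Inclusion-exclusion: the alternating sum over the sets `U` disjoint from the image of `r`
  -- vanishes unless `r` is surjective, that is, a permutation.
  have h2 : ∀ r : ι → ι, (∑ U : Finset ι, (-1 : ℤ) ^ U.card •
      if U ⊆ (Finset.univ.image r)ᶜ then f (fun i => z (r i)) else 0) =
      if Function.Bijective r then f (fun i => z (r i)) else 0 := by
    intro r
    have : ∀ U : Finset ι, ((-1 : ℤ) ^ U.card •
        if U ⊆ (Finset.univ.image r)ᶜ then f (fun i => z (r i)) else 0) =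
        (if U ⊆ (Finset.univ.image r)ᶜ then (-1 : ℤ) ^ U.card else 0) • f (fun i => z (r i)) := by
      intro U; split_ifs <;> simp
    simp only [this, ← Finset.sum_smul, ← Finset.sum_filter]
    rw [show (Finset.univ.filter fun U => U ⊆ (Finset.univ.image r)ᶜ) =
      (Finset.univ.image r)ᶜ.powerset by ext; simp, Finset.sum_powerset_neg_one_pow_card]
    have : (Finset.univ.image r)ᶜ = ∅ ↔ Function.Bijective r := by
      rw [Finset.compl_eq_empty_iff, Finset.eq_univ_iff_forall, ← Finite.surjective_iff_bijective]
      simp [Function.Surjective]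
    simp only [this]
    split_ifs <;> simp
  simp only [h1, Finset.smul_sum]
  rw [Finset.sum_comm]
  simp only [h2, ← Finset.sum_filter]
  refine Finset.sum_bij (fun σ _ => σ) (fun σ _ => by simp)
    (fun σ _ ρ _ h => DFunLike.coe_injective h) (fun r hr => ?_) fun _ _ => rfl
  exact ⟨Equiv.ofBijective r (by simpa using hr), Finset.mem_univ _, rfl⟩

end Polarization

/-! ### The first fundamental theorem for `GL(V)`. -/

section SchurWeyl

open Module

variable {F : Type*} [Field F] [CharZero F] {V : Type*} [AddCommGroup V] [Module F V]
  [FiniteDimensional F V] {m : ℕ}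

/-- Summing the conjugates of a pure tensor over `Sₘ` symmetrizes it, and polarization writes the
result through diagonal tensors. An operator commuting with `Sₘ` is `1/m!` times its own sum of
conjugates. -/
theorem mem_span_map_const_of_commute_permTensor {a : End F (⨂[F] _ : Fin m, V)}
    (ha : ∀ σ, Commute (permTensor F V σ) a) :
    a ∈ Submodule.span F (Set.range fun u : End F V => PiTensorProduct.map fun _ : Fin m => u) := by
  set S := Submodule.span F (Set.range fun u : End F V => PiTensorProduct.map fun _ : Fin m => u)
  have key : ∀ b : End F (⨂[F] _ : Fin m, V),
      (∑ σ : Equiv.Perm (Fin m), permTensor F V σ * b * permTensor F V σ⁻¹) ∈ S := by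
    intro b
    have hb : b ∈ Submodule.span F
        (Set.range fun z : Fin m → End F V => PiTensorProduct.map z) := by
      rw [span_range_map]; trivial
    induction hb using Submodule.span_induction with
    | mem x hx =>
      obtain ⟨z, rfl⟩ := hx
      have h : ∀ σ : Equiv.Perm (Fin m),
          permTensor F V σ * PiTensorProduct.map z * permTensor F V σ⁻¹ =
            PiTensorProduct.mapMultilinear F (fun _ : Fin m => V) (fun _ => V)
              (fun i => z (σ⁻¹ i)) := by
        intro σ
        rw [permTensor_mul_map, mul_assoc]
        have : permTensor F V σ * permTensor F V σ⁻¹ = 1 := by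
          change permTensorHom F V m σ * permTensorHom F V m σ⁻¹ = 1
          rw [← map_mul, mul_inv_cancel, map_one]
        rw [this, mul_one]
        rfl
      simp only [h]
      have hsum := Equiv.sum_comp (Equiv.inv (Equiv.Perm (Fin m))) fun σ : Equiv.Perm (Fin m) =>
        PiTensorProduct.mapMultilinear F (fun _ : Fin m => V) (fun _ => V) (fun i => z (σ i))
      simp only [Equiv.inv_apply] at hsum
      rw [hsum, MultilinearMap.sum_perm_eq_sum_neg_one_pow]
      refine S.sum_mem fun U _ => zsmul_mem ?_ _
      exact Submodule.subset_span ⟨∑ j ∈ Uᶜ, z j, rfl⟩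
    | zero => simp
    | add x y _ _ hx hy =>
      simp only [mul_add, add_mul, Finset.sum_add_distrib]
      exact S.add_mem hx hy
    | smul c x _ hx =>
      simp only [mul_smul_comm, smul_mul_assoc, ← Finset.smul_sum]
      exact S.smul_mem c hx
  have h := key a
  have h' : ∀ σ : Equiv.Perm (Fin m), permTensor F V σ * a * permTensor F V σ⁻¹ = a := by
    intro σ
    rw [(ha σ).eq, mul_assoc]
    change a * (permTensorHom F V m σ * permTensorHom F V m σ⁻¹) = a
    rw [← map_mul, mul_inv_cancel, map_one, mul_one]
  simp only [h', Finset.sum_const, Finset.card_univ, ← Nat.cast_smul_eq_nsmul F] at h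
  have hc : (Fintype.card (Equiv.Perm (Fin m)) : F) ≠ 0 := Nat.cast_ne_zero.2 Fintype.card_ne_zero
  rw [← inv_smul_smul₀ hc a]
  exact S.smul_mem _ h

/-- Density of `GL(V)` in `End(V)`, used only along the line `t • 1 + u`: commutation is polynomial
in `t`, so it extends from invertible values to `t = 0`. -/
theorem commute_map_const_of_mem_glEnd {f : End F (⨂[F] _ : Fin m, V)} (hf : f ∈ glEnd F V m)
    (u : End F V) : Commute f (PiTensorProduct.map fun _ : Fin m => u) := by
  have hGL : ∀ g : End F V, IsUnit g → Commute f (PiTensorProduct.map fun _ : Fin m => g) := by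
    intro g hg
    have h := (Subalgebra.mem_centralizer_iff F).1 hf _
      ⟨LinearMap.GeneralLinearGroup.generalLinearEquiv F V hg.unit, rfl⟩
    exact h.symm
  change f * _ = _ * f
  rw [← sub_eq_zero, ← forall_dual_apply_eq_zero_iff F]
  intro ψ
  let M := PiTensorProduct.mapMultilinear F (fun _ : Fin m => V) (fun _ => V)
  let χ : End F (⨂[F] _ : Fin m, V) →ₗ[F] F :=
    ψ ∘ₗ (LinearMap.mulLeft F f - LinearMap.mulRight F f)
  -- `P` evaluates at `t` to `ψ` of the commutator of `f` with the `m`-th tensor power of `t • 1 +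
  -- u`; `s` is the set of slots taking `t • 1`.
  let P : Polynomial F := ∑ s : Finset (Fin m),
    Polynomial.C (χ (M (s.piecewise (fun _ => 1) fun _ => u))) * Polynomial.X ^ s.card
  have hP : ∀ t : F, P.eval t = χ (M fun _ => t • 1 + u) := by
    intro t
    have h1 := M.map_add_univ (fun _ => t • 1) (fun _ => u)
    rw [show ((fun _ => t • 1) + fun _ => u : Fin m → End F V) = fun _ => t • 1 + u from rfl] at h1
    rw [h1, map_sum, Polynomial.eval_finsetSum]
    refine Finset.sum_congr rfl fun s _ => ?_
    have h2 := M.map_piecewise_smul (fun _ => t) (s.piecewise (fun _ => 1) fun _ => u) s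
    have h3 : s.piecewise (fun i => t • (s.piecewise (fun _ => 1) fun _ => u : Fin m → End F V) i)
        (s.piecewise (fun _ => 1) fun _ => u) =
        (s.piecewise (fun _ => t • 1) fun _ => u : Fin m → End F V) := by
      ext1 i
      by_cases hi : i ∈ s <;> simp [hi]
    rw [h3] at h2
    rw [h2, map_smul, Polynomial.eval_mul, Polynomial.eval_C, Polynomial.eval_pow,
      Polynomial.eval_X, Finset.prod_const, smul_eq_mul, mul_comm]
  have hP0 : P = 0 := by
    refine Polynomial.eq_zero_of_infinite_isRoot P ?_
    -- `t • 1 + u` is invertible off the finite spectrum of `-u`, and `F` is infinite.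
    refine ((Module.End.finite_spectrum (-u)).infinite_compl).mono fun t ht => ?_
    have ht : IsUnit (algebraMap F (End F V) t - -u) := by
      simpa [spectrum.notMem_iff] using ht
    rw [sub_neg_eq_add, Algebra.algebraMap_eq_smul_one] at ht
    have := (hGL _ ht).eq
    change P.eval t = 0
    rw [hP]
    change ψ (f * _ - _ * f) = 0
    exact (congrArg ψ (sub_eq_zero.2 this)).trans (map_zero ψ)
  have := hP 0
  rw [hP0, Polynomial.eval_zero, zero_smul, zero_add] at this
  exact this.symm

/-- The first fundamental theorem: the operators commuting with `GL(V)` are spanned by the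
permutations of the tensor factors. -/
theorem span_range_permTensor :
    Submodule.span F (Set.range (permTensor F V : Equiv.Perm (Fin m) → _)) =
      Subalgebra.toSubmodule (glEnd F V m) := by
  refine le_antisymm (Submodule.span_le.2 ?_) fun f hf => ?_
  · rintro _ ⟨σ, rfl⟩
    exact permTensor_mem_glEnd σ
  · refine mem_span_range_of_commute_centralizer (permTensorHom F V m) f fun a ha => ?_
    have := mem_span_map_const_of_commute_permTensor ha
    clear ha
    induction this using Submodule.span_induction with
    | mem x hx => obtain ⟨u, rfl⟩ := hx; exact commute_map_const_of_mem_glEnd hf u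
    | zero => exact Commute.zero_right f
    | add x y _ _ hx hy => exact hx.add_right hy
    | smul c x _ hx => exact hx.smul_right c

end SchurWeyl

/-! ### Trace duality between multilinear maps and operators. -/

section Interpretation

open Module

variable {F : Type*} [Field F] {V : Type*} [AddCommGroup V] [Module F V] {n k m : ℕ}

/-- `H` and the operator `A` on `V^{⊗ (n + k)}` correspond to each other under the trace form. -/
def TraceDual (H : MultilinearMap F (fun _ : Fin k => End F V) (⨂[F] _ : Fin n, End F V))
    (A : End F (⨂[F] _ : Fin (n + k), V)) : Prop :=
  ∀ (x : Fin k → End F V) (y : Fin n → End F V),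
    LinearMap.trace F (⨂[F] _ : Fin n, V) (tensorEnd F V n (H x) * PiTensorProduct.map y) =
      LinearMap.trace F (⨂[F] _ : Fin (n + k), V) (A * PiTensorProduct.map (Fin.append y x))

theorem map_conj_symm (g : V ≃ₗ[F] V) (z : Fin m → End F V) :
    PiTensorProduct.map (fun i => g.symm.conj (z i)) =
      PiTensorProduct.map (fun _ : Fin m => g.symm.toLinearMap) * PiTensorProduct.map z *
        PiTensorProduct.map (fun _ : Fin m => g.toLinearMap) := by
  rw [← PiTensorProduct.map_mul, ← PiTensorProduct.map_mul]
  rfl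

theorem map_const_mul_map_const_symm (g : V ≃ₗ[F] V) :
    PiTensorProduct.map (fun _ : Fin m => g.toLinearMap) *
      PiTensorProduct.map (fun _ : Fin m => g.symm.toLinearMap) = 1 := by
  rw [← PiTensorProduct.map_mul, ← PiTensorProduct.map_one]
  congr 1
  ext
  simp

theorem tensorEnd_map_conj (g : V ≃ₗ[F] V) (t : ⨂[F] _ : Fin m, End F V) :
    tensorEnd F V m (PiTensorProduct.map (fun _ : Fin m => g.conj.toLinearMap) t) =
      PiTensorProduct.map (fun _ : Fin m => g.toLinearMap) * tensorEnd F V m t *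
        PiTensorProduct.map (fun _ : Fin m => g.symm.toLinearMap) := by
  induction t using PiTensorProduct.induction_on with
  | smul_tprod r z =>
    simp only [map_smul, PiTensorProduct.map_tprod, tensorEnd_tprod, mul_smul_comm,
      smul_mul_assoc]
    congr 1
    exact map_conj_symm g.symm z
  | add a b ha hb => simp only [map_add, mul_add, add_mul, ha, hb]

theorem mem_glEnd_iff {A : End F (⨂[F] _ : Fin m, V)} :
    A ∈ glEnd F V m ↔ ∀ g : V ≃ₗ[F] V,
      PiTensorProduct.map (fun _ : Fin m => g.toLinearMap) * A *
        PiTensorProduct.map (fun _ : Fin m => g.symm.toLinearMap) = A := by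
  have h1 := fun g : V ≃ₗ[F] V => map_const_mul_map_const_symm (m := m) g
  have h2 := fun g : V ≃ₗ[F] V => map_const_mul_map_const_symm (m := m) g.symm
  simp only [LinearEquiv.symm_symm] at h2
  rw [glEnd, Subalgebra.mem_centralizer_iff, Set.forall_mem_range]
  refine forall_congr' fun g => ⟨fun h => ?_, fun h => ?_⟩
  · rw [h, mul_assoc, h1, mul_one]
  · conv_rhs => rw [← h, mul_assoc, h2, mul_one]

variable [FiniteDimensional F V]

theorem tensorEnd_eq_of_trace_mul_map_eq {s t : ⨂[F] _ : Fin n, End F V}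
    (h : ∀ y : Fin n → End F V,
      LinearMap.trace F _ (tensorEnd F V n s * PiTensorProduct.map y) =
        LinearMap.trace F _ (tensorEnd F V n t * PiTensorProduct.map y)) : s = t :=
  tensorEnd_bijective.1 (eq_of_trace_mul_map_eq h)

theorem TraceDual.left_unique
    {H K : MultilinearMap F (fun _ : Fin k => End F V) (⨂[F] _ : Fin n, End F V)}
    {A : End F (⨂[F] _ : Fin (n + k), V)} (hH : TraceDual H A) (hK : TraceDual K A) : H = K :=
  MultilinearMap.ext fun x => tensorEnd_eq_of_trace_mul_map_eq fun y =>
    (hH x y).trans (hK x y).symm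

theorem TraceDual.right_unique
    {H : MultilinearMap F (fun _ : Fin k => End F V) (⨂[F] _ : Fin n, End F V)}
    {A B : End F (⨂[F] _ : Fin (n + k), V)} (hA : TraceDual H A) (hB : TraceDual H B) : A = B :=
  eq_of_trace_mul_map_eq fun z => by
    have := (hA (fun i => z (Fin.natAdd n i)) fun i => z (Fin.castAdd k i)).symm.trans
      (hB (fun i => z (Fin.natAdd n i)) fun i => z (Fin.castAdd k i))
    rwa [Fin.append_castAdd_natAdd] at this

/-- Conjugating `H` by `g` conjugates its partner by `g`, since the trace is invariant. Partners
determine each other, so one is fixed by all `g` exactly when the other is. -/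
theorem TraceDual.mem_equivariantMaps_iff
    {H : MultilinearMap F (fun _ : Fin k => End F V) (⨂[F] _ : Fin n, End F V)}
    {A : End F (⨂[F] _ : Fin (n + k), V)} (h : TraceDual H A) :
    H ∈ equivariantMaps F V n k ↔ A ∈ glEnd F V (n + k) := by
  let c : (V ≃ₗ[F] V) → MultilinearMap F (fun _ : Fin k => End F V) (⨂[F] _ : Fin n, End F V) :=
    fun g => (PiTensorProduct.map (fun _ : Fin n => g.conj.toLinearMap)).compMultilinearMap
      (H.compLinearMap fun _ => g.symm.conj.toLinearMap)
  have hc : ∀ g, TraceDual (c g) (PiTensorProduct.map (fun _ => g.toLinearMap) * A *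
      PiTensorProduct.map (fun _ => g.symm.toLinearMap)) := by
    intro g x y
    have e := h (fun i => g.symm.conj (x i)) (fun i => g.symm.conj (y i))
    have e' : Fin.append (fun i => g.symm.conj (y i)) (fun i => g.symm.conj (x i)) =
        fun i => g.symm.conj (Fin.append y x i) := by
      ext1 i
      refine Fin.addCases (fun i => ?_) (fun i => ?_) i <;> simp
    rw [e', map_conj_symm, map_conj_symm] at e
    change LinearMap.trace F _ (tensorEnd F V n (PiTensorProduct.map
      (fun _ : Fin n => g.conj.toLinearMap) (H fun i => g.symm.conj (x i))) * _) = _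
    rw [tensorEnd_map_conj, mul_assoc, mul_assoc, LinearMap.trace_mul_comm, mul_assoc _ A,
      mul_assoc _ (A * _), LinearMap.trace_mul_comm F (PiTensorProduct.map _)]
    simpa only [mul_assoc] using e
  rw [mem_glEnd_iff]
  constructor
  · intro hH g
    have : c g = H := by
      ext1 x
      change PiTensorProduct.map _ (H fun i => g.symm.conj (x i)) = H x
      rw [← hH g]
      congr 1
      ext1 i
      exact g.conj.apply_symm_apply (x i)
    exact (this ▸ hc g).right_unique h
  · intro hA g x
    have : c g = H := by
      have := hc g
      rw [hA g] at this
      exact this.left_unique h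
    conv_lhs => rw [← this]
    change PiTensorProduct.map _ (H fun i => g.symm.conj (g.conj (x i))) = _
    congr 2
    ext1 i
    exact g.conj.symm_apply_apply (x i)

variable (F V) in
/-- The trace form identifies operators on `V^{⊗ m}` with multilinear forms on `End(V)^m`. -/
theorem exists_linearEquiv_trace_mul_map (m : ℕ) :
    ∃ e : End F (⨂[F] _ : Fin m, V) ≃ₗ[F] MultilinearMap F (fun _ : Fin m => End F V) F,
      ∀ A z, e A z = LinearMap.trace F _ (A * PiTensorProduct.map z) := by
  let t : (⨂[F] _ : Fin m, End F V) ≃ₗ[F] End F (⨂[F] _ : Fin m, V) :=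
    LinearEquiv.ofBijective _ tensorEnd_bijective
  let f : End F (⨂[F] _ : Fin m, V) →ₗ[F] MultilinearMap F (fun _ : Fin m => End F V) F :=
    { toFun := fun A => (LinearMap.trace F _ ∘ₗ LinearMap.mulLeft F A).compMultilinearMap
        (PiTensorProduct.mapMultilinear F (fun _ : Fin m => V) fun _ => V)
      map_add' := fun A B => by ext; simp [add_mul]
      map_smul' := fun c A => by ext; simp }
  have hf : Function.Injective f := fun A B h =>
    eq_of_trace_mul_map_eq fun z => MultilinearMap.congr_fun h z
  -- Multilinear forms on `End(V)^m` are the dual of `End(V)^{⊗m}`, which has the dimension of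
  -- `End(V^{⊗m})`.
  refine ⟨LinearEquiv.ofInjectiveOfFinrankEq f hf ?_, fun A z => rfl⟩
  rw [← t.finrank_eq, ← Subspace.dual_finrank_eq]
  exact (PiTensorProduct.lift (R := F) (s := fun _ : Fin m => End F V) (E := F)).finrank_eq.symm

variable (F V n k) in
theorem exists_linearEquiv_traceDual :
    ∃ e : MultilinearMap F (fun _ : Fin k => End F V) (⨂[F] _ : Fin n, End F V) ≃ₗ[F]
        End F (⨂[F] _ : Fin (n + k), V), ∀ H, TraceDual H (e H) := by
  obtain ⟨a, ha⟩ := exists_linearEquiv_trace_mul_map F V n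
  obtain ⟨b, hb⟩ := exists_linearEquiv_trace_mul_map F V (n + k)
  let t : (⨂[F] _ : Fin n, End F V) ≃ₗ[F] End F (⨂[F] _ : Fin n, V) :=
    LinearEquiv.ofBijective _ tensorEnd_bijective
  let s := (t.trans a).multilinearMapCongrRight F (M₁ := fun _ : Fin k => End F V)
  let c := (MultilinearMap.currySumEquiv (R := F) (N := fun _ : Fin k ⊕ Fin n => End F V)
    (M₂ := F)).symm
  -- Uncurrying puts the `x` arguments before the `y` arguments; the swap restores the order `y, x`.
  let d := MultilinearMap.domDomCongrLinearEquiv F F (End F V) F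
    ((Equiv.sumComm (Fin k) (Fin n)).trans finSumFinEquiv)
  refine ⟨s.trans (c.trans (d.trans b.symm)), fun H x y => ?_⟩
  have h := hb (b.symm (d (c (s H)))) (Fin.append y x)
  rw [b.apply_symm_apply] at h
  refine Eq.trans ?_ h
  refine (ha _ _).symm.trans ?_
  change a (t (H x)) y = a (t (H fun i => Fin.append y x (Fin.natAdd n i)))
    fun i => Fin.append y x (Fin.castAdd k i)
  simp only [Fin.append_left, Fin.append_right]

variable (F V n k) in
/-- The identification of the equivariant maps with `End_{GL(V)}(V^{⊗ (n + k)})`. -/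
theorem existsUnique_linearEquiv_traceDual :
    ∃! Φ : equivariantMaps F V n k ≃ₗ[F] glEnd F V (n + k), ∀ H, TraceDual H.1 (Φ H).1 := by
  obtain ⟨e, he⟩ := exists_linearEquiv_traceDual F V n k
  have hmap : (equivariantMaps F V n k).map e.toLinearMap =
      Subalgebra.toSubmodule (glEnd F V (n + k)) := by
    ext A
    rw [Submodule.mem_map_equiv, (he (e.symm A)).mem_equivariantMaps_iff, e.apply_symm_apply]
    rfl
  refine ⟨e.ofSubmodules _ _ hmap, fun H => he H.1, fun Ψ hΨ => ?_⟩
  ext1 H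
  exact Subtype.ext ((hΨ H).right_unique (he H.1))

theorem span_range_eq_equivariantMaps [CharZero F]
    {T : Equiv.Perm (Fin (n + k)) →
      MultilinearMap F (fun _ : Fin k => End F V) (⨂[F] _ : Fin n, End F V)}
    (hT : ∀ τ, TraceDual (T τ) (permTensor F V τ⁻¹)) :
    Submodule.span F (Set.range T) = equivariantMaps F V n k := by
  obtain ⟨e, he⟩ := exists_linearEquiv_traceDual F V n k
  have heT : ∀ τ, e (T τ) = permTensor F V τ⁻¹ := fun τ => (he _).right_unique (hT τ)
  refine Submodule.map_injective_of_injective (f := e.toLinearMap) e.injective ?_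
  -- Inversion is a bijection of the symmetric group, so the operators of the `τ⁻¹` are those of all
  -- permutations.
  have hr : e '' Set.range T = Set.range (permTensor F V : Equiv.Perm (Fin (n + k)) → _) := by
    rw [← Set.range_comp, ← (Equiv.inv (Equiv.Perm (Fin (n + k)))).surjective.range_comp]
    exact congrArg Set.range (funext fun ρ => (heT ρ⁻¹).trans (by rw [inv_inv]))
  rw [Submodule.map_span]
  refine (congrArg (Submodule.span F) hr).trans (span_range_permTensor.trans ?_)
  ext A
  rw [Submodule.mem_map_equiv, (he (e.symm A)).mem_equivariantMaps_iff, e.apply_symm_apply]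
  rfl

end Interpretation

/-! ### Existence and uniqueness of the splitting. -/

section Splitting

variable {n k : ℕ}

@[simp]
theorem permOfA_castAdd (σ : Equiv.Perm (Fin n)) (a : Fin n) :
    permOfA k σ (Fin.castAdd k a) = Fin.castAdd k (σ a) := by
  simp [permOfA, Equiv.permCongr_apply]

@[simp]
theorem permOfA_natAdd (σ : Equiv.Perm (Fin n)) (b : Fin k) :
    permOfA k σ (Fin.natAdd n b) = Fin.natAdd n b := by
  simp [permOfA, Equiv.permCongr_apply]

@[simp]
theorem permOfB_castAdd (σ : Equiv.Perm (Fin k)) (a : Fin n) :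
    permOfB n σ (Fin.castAdd k a) = Fin.castAdd k a := by
  simp [permOfB, Equiv.permCongr_apply]

@[simp]
theorem permOfB_natAdd (σ : Equiv.Perm (Fin k)) (b : Fin k) :
    permOfB n σ (Fin.natAdd n b) = Fin.natAdd n (σ b) := by
  simp [permOfB, Equiv.permCongr_apply]

theorem castAdd_ne_natAdd (a : Fin n) (b : Fin k) : Fin.castAdd k a ≠ Fin.natAdd n b := by
  intro h
  have := congrArg Fin.val h
  simp only [Fin.val_castAdd, Fin.val_natAdd] at this
  omega

theorem cycleInB_iff_of_apply {τ : Equiv.Perm (Fin (n + k))} {b c : Fin k}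
    (h : Fin.natAdd n c = τ (Fin.natAdd n b)) : CycleInB τ c ↔ CycleInB τ b := by
  simp only [CycleInB, h, Equiv.Perm.sameCycle_apply_left]

/-- An excursion of `τ` from `a` into `B` is followed by `τ₁` from `a₀`, up to and including the
return to `A` at time `N + 1`. It serves both existence and uniqueness, so it assumes less than a
splitting. -/
theorem pow_succ_eq_of_forall_ne {τ τ₁ : Equiv.Perm (Fin (n + k))} {a a₀ : Fin n}
    (h₀ : τ₁ (Fin.castAdd k a₀) = τ (Fin.castAdd k a))
    (hB : ∀ b, ¬ CycleInB τ b → τ₁ (Fin.natAdd n b) = τ (Fin.natAdd n b)) {N : ℕ}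
    (hN : ∀ t < N, ∀ a', (τ ^ (t + 1)) (Fin.castAdd k a) ≠ Fin.castAdd k a') {t : ℕ}
    (ht : t ≤ N) : (τ₁ ^ (t + 1)) (Fin.castAdd k a₀) = (τ ^ (t + 1)) (Fin.castAdd k a) := by
  induction t with
  | zero => simpa using h₀
  | succ t ih =>
    rw [pow_succ' τ₁, pow_succ' τ, Equiv.Perm.mul_apply, Equiv.Perm.mul_apply, ih (by omega)]
    have hA := hN t (by omega)
    obtain ⟨b, hb⟩ : ∃ b, (τ ^ (t + 1)) (Fin.castAdd k a) = Fin.natAdd n b := by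
      revert hA
      refine Fin.addCases (fun a' h => (h a' rfl).elim) (fun b _ => ⟨b, rfl⟩)
        ((τ ^ (t + 1)) (Fin.castAdd k a))
    rw [hb]
    refine hB b fun h => h a ?_
    rw [← hb]
    exact (Equiv.Perm.sameCycle_pow_right.2 (Equiv.Perm.SameCycle.refl _ _)).symm

/-- Some positive power of `τ` is the identity, so a return to `A` occurs. The point `a'` is the
only possible value of `τ₃ a`. -/
theorem exists_first_return (τ : Equiv.Perm (Fin (n + k))) (a : Fin n) :
    ∃ (a' : Fin n) (N : ℕ), (τ ^ (N + 1)) (Fin.castAdd k a) = Fin.castAdd k a' ∧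
      ∀ t < N, ∀ a'', (τ ^ (t + 1)) (Fin.castAdd k a) ≠ Fin.castAdd k a'' := by
  classical
  have h : ∃ N, ∃ a', (τ ^ (N + 1)) (Fin.castAdd k a) = Fin.castAdd k a' := by
    refine ⟨orderOf τ - 1, a, ?_⟩
    rw [Nat.sub_add_cancel (orderOf_pos τ), pow_orderOf_eq_one, Equiv.Perm.one_apply]
  obtain ⟨a', ha'⟩ := Nat.find_spec h
  exact ⟨a', Nat.find h, ha', fun t ht a'' h' => Nat.find_min h ht ⟨a'', h'⟩⟩

namespace IsSplitting

variable {τ τ₁ : Equiv.Perm (Fin (n + k))} {τ₂ : Equiv.Perm (Fin k)} {τ₃ : Equiv.Perm (Fin n)}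

theorem apply_castAdd (h : IsSplitting τ τ₁ τ₂ τ₃) (a : Fin n) :
    τ (Fin.castAdd k a) = τ₁ (Fin.castAdd k (τ₃ a)) := by
  conv_lhs => rw [h.mul_eq]
  simp

theorem apply_natAdd (h : IsSplitting τ τ₁ τ₂ τ₃) (b : Fin k) :
    τ (Fin.natAdd n b) = τ₁ (Fin.natAdd n (τ₂ b)) := by
  conv_lhs => rw [h.mul_eq]
  simp

theorem cycleInB_two_apply (h : IsSplitting τ τ₁ τ₂ τ₃) (b : Fin k) :
    CycleInB τ (τ₂ b) ↔ CycleInB τ b := by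
  by_cases hb : CycleInB τ b
  · exact cycleInB_iff_of_apply (h.two_of_inB b hb)
  · rw [h.two_of_not_inB b hb]

theorem one_apply_of_inB (h : IsSplitting τ τ₁ τ₂ τ₃) {b : Fin k} (hb : CycleInB τ b) :
    τ₁ (Fin.natAdd n b) = Fin.natAdd n b := by
  obtain ⟨c, rfl⟩ := τ₂.surjective b
  rw [← h.apply_natAdd, h.two_of_inB c ((h.cycleInB_two_apply c).1 hb)]

theorem one_apply_of_not_inB (h : IsSplitting τ τ₁ τ₂ τ₃) {b : Fin k} (hb : ¬ CycleInB τ b) :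
    τ₁ (Fin.natAdd n b) = τ (Fin.natAdd n b) := by
  rw [h.apply_natAdd, h.two_of_not_inB b hb]

theorem eq_of_sameCycle_castAdd (h : IsSplitting τ τ₁ τ₂ τ₃) {a a' : Fin n}
    (ha : τ₁.SameCycle (Fin.castAdd k a) (Fin.castAdd k a')) : a = a' := by
  by_cases hf : τ₁ (Fin.castAdd k a) = Fin.castAdd k a
  · exact Fin.castAdd_injective _ _ ((Equiv.Perm.SameCycle.eq_of_left ha hf))
  · exact (h.cycle_one _ hf).unique (Equiv.Perm.SameCycle.refl _ _) ha

theorem three_apply_eq (h : IsSplitting τ τ₁ τ₂ τ₃) {a a' : Fin n} {N : ℕ}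
    (ha : (τ ^ (N + 1)) (Fin.castAdd k a) = Fin.castAdd k a')
    (hN : ∀ t < N, ∀ a'', (τ ^ (t + 1)) (Fin.castAdd k a) ≠ Fin.castAdd k a'') : τ₃ a = a' := by
  have := pow_succ_eq_of_forall_ne (h.apply_castAdd a).symm
    (fun b hb => h.one_apply_of_not_inB hb) hN le_rfl
  refine h.eq_of_sameCycle_castAdd ?_
  rw [← ha, ← this]
  exact Equiv.Perm.sameCycle_pow_right.2 (Equiv.Perm.SameCycle.refl _ _)

theorem unique (h : IsSplitting τ τ₁ τ₂ τ₃) {ρ₁ : Equiv.Perm (Fin (n + k))}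
    {ρ₂ : Equiv.Perm (Fin k)} {ρ₃ : Equiv.Perm (Fin n)} (h' : IsSplitting τ ρ₁ ρ₂ ρ₃) :
    τ₁ = ρ₁ ∧ τ₂ = ρ₂ ∧ τ₃ = ρ₃ := by
  have h₂ : τ₂ = ρ₂ := by
    ext1 b
    by_cases hb : CycleInB τ b
    · exact Fin.natAdd_injective _ _ ((h.two_of_inB b hb).trans (h'.two_of_inB b hb).symm)
    · rw [h.two_of_not_inB b hb, h'.two_of_not_inB b hb]
  have h₃ : τ₃ = ρ₃ := by
    ext1 a
    obtain ⟨a', N, ha, hN⟩ := exists_first_return τ a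
    rw [h.three_apply_eq ha hN, h'.three_apply_eq ha hN]
  refine ⟨?_, h₂, h₃⟩
  have := h.mul_eq.symm.trans h'.mul_eq
  rwa [h₂, h₃, mul_left_inj, mul_left_inj] at this

end IsSplitting

theorem exists_perm_restrict_cycleInB (τ : Equiv.Perm (Fin (n + k))) :
    ∃ τ₂ : Equiv.Perm (Fin k), (∀ b, CycleInB τ b → Fin.natAdd n (τ₂ b) = τ (Fin.natAdd n b)) ∧
      ∀ b, ¬ CycleInB τ b → τ₂ b = b := by
  have h : ∀ b : Fin k, ∃ c : Fin k,
      (CycleInB τ b → Fin.natAdd n c = τ (Fin.natAdd n b)) ∧ (¬ CycleInB τ b → c = b) := by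
    intro b
    by_cases hb : CycleInB τ b
    · have hA : ∀ a, τ (Fin.natAdd n b) ≠ Fin.castAdd k a := fun a h => hb a <| by
        rw [← h]
        exact Equiv.Perm.sameCycle_apply_right.2 (Equiv.Perm.SameCycle.refl _ _)
      obtain ⟨c, hc⟩ : ∃ c, τ (Fin.natAdd n b) = Fin.natAdd n c := by
        revert hA
        exact Fin.addCases (fun a h => (h a rfl).elim) (fun c _ => ⟨c, rfl⟩) (τ (Fin.natAdd n b))
      exact ⟨c, fun _ => hc.symm, fun h => (h hb).elim⟩
    · exact ⟨b, fun h => (hb h).elim, fun _ => rfl⟩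
  choose f hf hf' using h
  have hff : ∀ b, CycleInB τ (f b) ↔ CycleInB τ b := by
    intro b
    by_cases hb : CycleInB τ b
    · exact cycleInB_iff_of_apply (hf b hb)
    · rw [hf' b hb]
  have hinj : Function.Injective f := by
    intro b c hbc
    have hiff : CycleInB τ b ↔ CycleInB τ c := by rw [← hff b, hbc, hff]
    by_cases hb : CycleInB τ b
    · refine Fin.natAdd_injective _ n (τ.injective ?_)
      rw [← hf b hb, ← hf c (hiff.1 hb), hbc]
    · rwa [hf' b hb, hf' c fun h => hb (hiff.2 h)] at hbc
  exact ⟨Equiv.ofBijective f (Finite.injective_iff_bijective.1 hinj), hf, hf'⟩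

theorem exists_isSplitting (τ : Equiv.Perm (Fin (n + k))) :
    ∃ τ₁ τ₂ τ₃, IsSplitting τ τ₁ τ₂ τ₃ := by
  obtain ⟨τ₂, hB, hB'⟩ := exists_perm_restrict_cycleInB τ
  choose r N hr hN using exists_first_return (k := k) τ
  have hinj : Function.Injective r := by
    -- Run both excursions backwards from their common end: if they had different lengths, the
    -- longer one would meet `A` at the start of the shorter one, before its first return.
    have key : ∀ a a', r a = r a' → N a ≤ N a' → a = a' := by
      intro a a' h hle
      obtain ⟨d, hd⟩ := Nat.exists_eq_add_of_le hle
      have h1 : (τ ^ (N a + 1)) (Fin.castAdd k a) = (τ ^ (N a' + 1)) (Fin.castAdd k a') := by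
        rw [hr, hr, h]
      rw [hd, add_right_comm, pow_add _ (N a + 1), Equiv.Perm.mul_apply] at h1
      have h2 := (τ ^ (N a + 1)).injective h1
      cases d with
      | zero =>
        exact Fin.castAdd_injective _ _
          (show Fin.castAdd k a = Fin.castAdd k a' by simpa using h2)
      | succ d => exact (hN a' d (by omega) a h2.symm).elim
    intro a a' h
    rcases le_total (N a) (N a') with hle | hle
    · exact key a a' h hle
    · exact (key a' a h.symm hle).symm
  let τ₃ : Equiv.Perm (Fin n) := Equiv.ofBijective r (Finite.injective_iff_bijective.1 hinj)
  let τ₁ : Equiv.Perm (Fin (n + k)) := τ * (permOfA k τ₃)⁻¹ * (permOfB n τ₂)⁻¹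
  have hmul : τ = τ₁ * permOfB n τ₂ * permOfA k τ₃ := by simp [τ₁]
  have hA₁ : ∀ a, τ₁ (Fin.castAdd k (r a)) = τ (Fin.castAdd k a) := by
    intro a
    conv_rhs => rw [hmul]
    simp [τ₃]
  have hB₁ : ∀ b, τ₁ (Fin.natAdd n (τ₂ b)) = τ (Fin.natAdd n b) := by
    intro b
    conv_rhs => rw [hmul]
    simp
  have hnot : ∀ b, ¬ CycleInB τ b → τ₁ (Fin.natAdd n b) = τ (Fin.natAdd n b) := fun b hb => by
    rw [← hB₁, hB' b hb]
  have hin : ∀ b, CycleInB τ b → τ₁ (Fin.natAdd n b) = Fin.natAdd n b := by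
    intro b hb
    obtain ⟨c, rfl⟩ := τ₂.surjective b
    have hc : CycleInB τ c := by
      by_contra hc
      rw [hB' c hc] at hb
      exact hc hb
    rw [hB₁, hB c hc]
  have huniq : ∀ a a', τ₁.SameCycle (Fin.castAdd k a) (Fin.castAdd k a') → a = a' := by
    intro a a' h
    obtain ⟨a, rfl⟩ := τ₃.surjective a
    change τ₁.SameCycle (Fin.castAdd k (r a)) _ at h
    have hwalk := fun t ht => pow_succ_eq_of_forall_ne (t := t) (hA₁ a) hnot (hN a) ht
    -- The walk from `r a` under `τ₁` closes up after `N a + 1` steps, and its intermediate points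
    -- avoid `A`.
    have hper : Function.IsPeriodicPt τ₁ (N a + 1) (Fin.castAdd k (r a)) := by
      rw [Function.IsPeriodicPt, Function.IsFixedPt, Equiv.Perm.iterate_eq_pow,
        hwalk _ le_rfl, hr]
    obtain ⟨j, hj⟩ := h.exists_nat_pow_eq
    rw [← Equiv.Perm.iterate_eq_pow, ← hper.iterate_mod_apply, Equiv.Perm.iterate_eq_pow] at hj
    have hlt := Nat.mod_lt j (Nat.succ_pos (N a))
    change j % (N a + 1) < N a + 1 at hlt
    generalize j % (N a + 1) = i at hj hlt
    cases i with
    | zero =>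
      exact Fin.castAdd_injective _ _
        (show Fin.castAdd k (r a) = Fin.castAdd k a' by simpa using hj)
    | succ t =>
      rw [hwalk t (by omega)] at hj
      exact (hN a t (by omega) a' hj).elim
  refine ⟨τ₁, τ₂, τ₃, hmul, fun i hi => ?_, hB, hB'⟩
  suffices ∃ a, τ₁.SameCycle i (Fin.castAdd k a) by
    obtain ⟨a, ha⟩ := this
    exact ⟨a, ha, fun a' ha' => (huniq a a' (ha.symm.trans ha')).symm⟩
  induction i using Fin.addCases with
  | left a => exact ⟨a, Equiv.Perm.SameCycle.refl _ _⟩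
  | right b =>
    classical
    have hb : ¬ CycleInB τ b := fun hb => hi (hin b hb)
    -- The least such `j`, over all `a`, starts the walk at the last visit of `τ` to `A` before `n +
    -- b`, so no intermediate point is in `A`.
    have hex : ∃ j a, (τ ^ j) (Fin.castAdd k a) = Fin.natAdd n b := by
      simp only [CycleInB, not_forall, not_not] at hb
      obtain ⟨a, ha⟩ := hb
      obtain ⟨j, hj⟩ := ha.symm.exists_nat_pow_eq
      exact ⟨j, a, hj⟩
    obtain ⟨a, ha⟩ := Nat.find_spec hex
    have hmin := fun {j} (hj : j < Nat.find hex) => Nat.find_min hex hj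
    generalize Nat.find hex = j at ha hmin
    cases j with
    | zero => exact (castAdd_ne_natAdd a b (by simpa using ha)).elim
    | succ t =>
      refine ⟨r a, ?_⟩
      have hwalk := pow_succ_eq_of_forall_ne (N := t) (hA₁ a) hnot (fun s hs a' h' => ?_) le_rfl
      · rw [← ha, ← hwalk]
        exact (Equiv.Perm.sameCycle_pow_right.2 (Equiv.Perm.SameCycle.refl _ _)).symm
      · refine hmin (j := t - s) (by omega) ⟨a', ?_⟩
        rw [← h', ← Equiv.Perm.mul_apply, ← pow_add, ← ha]
        congr 2
        omega

theorem existsUnique_isSplitting (τ : Equiv.Perm (Fin (n + k))) :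
    ∃! s : Equiv.Perm (Fin (n + k)) × Equiv.Perm (Fin k) × Equiv.Perm (Fin n),
      IsSplitting τ s.1 s.2.1 s.2.2 := by
  obtain ⟨τ₁, τ₂, τ₃, h⟩ := exists_isSplitting τ
  refine ⟨(τ₁, τ₂, τ₃), h, fun s hs => ?_⟩
  obtain ⟨h₁, h₂, h₃⟩ := hs.unique h
  exact Prod.ext h₁ (Prod.ext h₂ h₃)

end Splitting

/-! ### Contraction of cycle segments under the trace. -/

section CycleTraceFormula

open Module

/-- Substituting ordered products into a multilinear form on an algebra. -/
def MultilinearMap.sigmaProd {F A ι : Type*} [CommSemiring F] [Semiring A] [Algebra F A]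
    (L : MultilinearMap F (fun _ : ι => A) F) (q : ι → ℕ) :
    MultilinearMap F (fun _ : (Σ i, Fin (q i)) => A) F :=
  have key : ∀ [DecidableEq ι] [d : DecidableEq (Σ i, Fin (q i))] (z : (Σ i, Fin (q i)) → A)
      (s : Σ i, Fin (q i)) (w : A),
      (fun i => MultilinearMap.mkPiAlgebraFin F (q i) A
        fun j => Function.update z s w ⟨i, j⟩) =
      Function.update (fun i => MultilinearMap.mkPiAlgebraFin F (q i) A fun j => z ⟨i, j⟩) s.1
        (MultilinearMap.mkPiAlgebraFin F (q s.1) A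
          (Function.update (fun j => z ⟨s.1, j⟩) s.2 w)) := by
    intro _ d z s w
    obtain rfl : d = fun a b => instDecidableEqSigma a b := Subsingleton.elim _ _
    have hs := Sigma.curry_update (γ := fun _ _ => A) s z w
    ext1 i
    refine (congrArg (MultilinearMap.mkPiAlgebraFin F (q i) A) (congrFun hs i)).trans ?_
    by_cases h : i = s.1
    · subst h
      simp only [Function.update_self]
      rfl
    · simp only [Function.update_of_ne h]
      rfl
  { toFun := fun z => L fun i => MultilinearMap.mkPiAlgebraFin F (q i) A fun j => z ⟨i, j⟩
    map_update_add' := fun z s a b => by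
      classical
      simp only [key, MultilinearMap.map_update_add]
    map_update_smul' := fun z s c a => by
      classical
      simp only [key, MultilinearMap.map_update_smul] }

theorem MultilinearMap.sigmaProd_apply {F A ι : Type*} [CommSemiring F] [Semiring A] [Algebra F A]
    (L : MultilinearMap F (fun _ : ι => A) F) (q : ι → ℕ) (z : (Σ i, Fin (q i)) → A) :
    L.sigmaProd q z = L fun i => (List.ofFn fun j => z ⟨i, j⟩).prod := rfl

variable {F : Type*} [Field F] {V : Type*} [AddCommGroup V] [Module F V]

/-- Adjacent rank one factors contract to scalars; only the first vector and the last form survive.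
-/
theorem prod_ofFn_smulRight (q : ℕ) (v : Fin (q + 1) → V) (φ : Fin (q + 1) → Dual F V) :
    (List.ofFn fun j => ((φ j).smulRight (v j) : End F V)).prod =
      (∏ j : Fin q, φ j.castSucc (v j.succ)) • (φ (Fin.last q)).smulRight (v 0) := by
  induction q with
  | zero => simp
  | succ q ih =>
    rw [List.ofFn_succ, List.prod_cons, ih (fun j => v j.succ) fun j => φ j.succ,
      Fin.prod_univ_succ]
    ext w
    simp [smul_smul, mul_comm, mul_assoc]

variable [FiniteDimensional F V] {m n : ℕ}

/-- The trace of a permutation composed with `z₁ ⊗ ⋯ ⊗ zₘ`, after contracting segments of the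
cycles of the permutation. -/
theorem trace_permTensor_mul_map_eq {C : Type*} [Fintype C] (τ : Equiv.Perm (Fin m))
    (σ : Equiv.Perm (Fin n)) (q : Fin n ⊕ C → ℕ) (e : (Σ r, Fin (q r + 1)) ≃ Fin m)
    (h₁ : ∀ r (j : Fin (q r)), τ (e ⟨r, j.castSucc⟩) = e ⟨r, j.succ⟩)
    (h₂ : ∀ a, τ (e ⟨.inl a, Fin.last _⟩) = e ⟨.inl (σ a), 0⟩)
    (h₃ : ∀ c, τ (e ⟨.inr c, Fin.last _⟩) = e ⟨.inr c, 0⟩) (z : Fin m → End F V) :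
    LinearMap.trace F _ (permTensor F V τ⁻¹ * PiTensorProduct.map z) =
      LinearMap.trace F _ (permTensor F V σ⁻¹ *
        PiTensorProduct.map fun a => (List.ofFn fun j => z (e ⟨.inl a, j⟩)).prod) *
      ∏ c, LinearMap.trace F V (List.ofFn fun j => z (e ⟨.inr c, j⟩)).prod := by
  let f (m : ℕ) (σ : Equiv.Perm (Fin m)) : MultilinearMap F (fun _ : Fin m => End F V) F :=
    (LinearMap.trace F _ ∘ₗ LinearMap.mulLeft F (permTensor F V σ⁻¹)).compMultilinearMap
      (PiTensorProduct.mapMultilinear F (fun _ : Fin m => V) fun _ => V)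
  let g : MultilinearMap F (fun _ : C => End F V) F :=
    (MultilinearMap.mkPiAlgebra F C F).compLinearMap fun _ => LinearMap.trace F V
  let L : MultilinearMap F (fun _ : Fin n ⊕ C => End F V) F :=
    (LinearMap.mul' F F).compMultilinearMap ((f n σ).domCoprod g)
  have hL : ∀ w, L w = LinearMap.trace F _ (permTensor F V σ⁻¹ *
      PiTensorProduct.map fun a => w (.inl a)) * ∏ c, LinearMap.trace F V (w (.inr c)) :=
    fun w => rfl
  -- Both sides are multilinear in `z`, and rank one operators span `End(V)`.
  have hfL : (f m τ).domDomCongr e.symm = L.sigmaProd fun r => q r + 1 := by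
    refine MultilinearMap.ext_of_span_eq_top
      (g := fun _ (p : V × Dual F V) => (p.2.smulRight p.1 : End F V))
      (fun _ => span_range_smulRight) fun p => ?_
    have hl : (f m τ).domDomCongr e.symm (fun s => (p s).2.smulRight (p s).1) =
        ∏ i, (p (e.symm i)).2 (p (e.symm (τ i))).1 :=
      trace_permTensor_mul_map_smulRight τ (fun i => (p (e.symm i)).1) fun i => (p (e.symm i)).2
    rw [hl, MultilinearMap.sigmaProd_apply]
    simp only [prod_ofFn_smulRight]
    rw [MultilinearMap.map_smul_univ, hL, trace_permTensor_mul_map_smulRight]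
    simp only [LinearMap.trace_smulRight]
    -- Pairings inside a segment match the contraction scalars by `h₁`; those at segment ends match
    -- the pairings of `σ` by `h₂` and the traces by `h₃`.
    rw [← e.prod_comp, Fintype.prod_sigma]
    simp only [Fin.prod_univ_castSucc, h₁, e.symm_apply_apply]
    rw [Finset.prod_mul_distrib, smul_eq_mul]
    congr 1
    rw [Fintype.prod_sum_type]
    simp only [h₂, h₃, e.symm_apply_apply]
  have := MultilinearMap.congr_fun hfL fun s => z (e s)
  rw [MultilinearMap.sigmaProd_apply, hL, MultilinearMap.domDomCongr_apply] at this
  simp only [e.apply_symm_apply] at this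
  exact this

end CycleTraceFormula

/-! ### The explicit formula for the interpretation. -/

section InterpretationFormula

open Module

variable {n k : ℕ} {τ τ₁ : Equiv.Perm (Fin (n + k))} {τ₂ : Equiv.Perm (Fin k)}
  {τ₃ : Equiv.Perm (Fin n)}

theorem Equiv.Perm.sameCycle_iterate {α : Type*} (σ : Equiv.Perm α) (t : ℕ) (i : α) :
    σ.SameCycle i (σ^[t] i) := by
  rw [Equiv.Perm.iterate_eq_pow]
  exact Equiv.Perm.sameCycle_pow_right.2 (Equiv.Perm.SameCycle.refl _ _)

theorem Equiv.Perm.minimalPeriod_pos {α : Type*} [Finite α] (σ : Equiv.Perm α) (i : α) :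
    0 < Function.minimalPeriod σ i :=
  Function.minimalPeriod_pos_of_mem_periodicPts
    (Function.Injective.mem_periodicPts σ.injective i)

theorem Equiv.Perm.SameCycle.exists_iterate_eq {α : Type*} [Finite α] {σ : Equiv.Perm α} {i j : α}
    (h : σ.SameCycle i j) : ∃ t < Function.minimalPeriod σ i, σ^[t] i = j := by
  obtain ⟨s, hs⟩ := h.exists_nat_pow_eq
  refine ⟨s % Function.minimalPeriod σ i, Nat.mod_lt _ (Equiv.Perm.minimalPeriod_pos σ i), ?_⟩
  rw [Function.iterate_mod_minimalPeriod_eq, Equiv.Perm.iterate_eq_pow, hs]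

theorem List.ofFn_iterate {α β : Type*} (f : α → α) (i : α) (z : α → β) (q : ℕ) :
    (List.ofFn fun j : Fin q => z (f^[j] i)) = (List.iterate f i q).map z := by
  rw [← List.range_map_iterate, List.map_map, List.ofFn_eq_map, ← List.map_coe_finRange_eq_range,
    List.map_map]
  rfl

namespace IsSplitting

theorem cycleInB_iterate (h : IsSplitting τ τ₁ τ₂ τ₃) {b : Fin k} (hb : CycleInB τ b) (t : ℕ) :
    CycleInB τ (τ₂^[t] b) := by
  induction t with
  | zero => exact hb
  | succ t ih =>
    rw [Function.iterate_succ_apply']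
    exact (h.cycleInB_two_apply _).2 ih

theorem not_sameCycle_of_cycleInB (h : IsSplitting τ τ₁ τ₂ τ₃) {b : Fin k} (hb : CycleInB τ b)
    (a : Fin n) : ¬ τ₁.SameCycle (Fin.castAdd k a) (Fin.natAdd n b) := fun hab =>
  castAdd_ne_natAdd a b (hab.eq_of_right (h.one_apply_of_inB hb))

/-- The cycle of `τ₁` through `a ∈ A` lies in `B` except for `a`. -/
theorem exists_iterate_eq_natAdd (h : IsSplitting τ τ₁ τ₂ τ₃) (a : Fin n) {t : ℕ}
    (ht : t + 1 < Function.minimalPeriod τ₁ (Fin.castAdd k a)) :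
    ∃ b, τ₁^[t + 1] (Fin.castAdd k a) = Fin.natAdd n b ∧ ¬ CycleInB τ b := by
  have hs := Equiv.Perm.sameCycle_iterate τ₁ (t + 1) (Fin.castAdd k a)
  have hne : ∀ a', τ₁^[t + 1] (Fin.castAdd k a) ≠ Fin.castAdd k a' := by
    intro a' ha'
    rw [ha'] at hs
    rw [← h.eq_of_sameCycle_castAdd hs] at ha'
    exact Function.not_isPeriodicPt_of_pos_of_lt_minimalPeriod (Nat.succ_ne_zero t) ht ha'
  generalize τ₁^[t + 1] (Fin.castAdd k a) = i at hs hne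
  induction i using Fin.addCases with
  | left a' => exact (hne a' rfl).elim
  | right b => exact ⟨b, rfl, fun hb => h.not_sameCycle_of_cycleInB hb a hs⟩

/-- The elements that represent the cycles of `τ` contained in `B`. -/
abbrev IsRep (τ : Equiv.Perm (Fin (n + k))) (τ₂ : Equiv.Perm (Fin k)) (b : Fin k) : Prop :=
  CycleInB τ b ∧ ∀ b', τ₂.SameCycle b b' → b ≤ b'

/-- The points of the cycles of `τ₁` through `A`, and of the cycles of `τ₂` in `B`. -/
def point (τ τ₁ : Equiv.Perm (Fin (n + k))) (τ₂ : Equiv.Perm (Fin k)) :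
    Fin n ⊕ {b // IsRep τ τ₂ b} → ℕ → Fin (n + k)
  -- The shift makes the list start at `τ₁ a` and end at `a`, so that `y a` is the last factor,
  -- after the monomial.
  | .inl a, t => τ₁^[t + 1] (Fin.castAdd k a)
  | .inr c, t => Fin.natAdd n (τ₂^[t] c.1)

/-- The lengths of these cycles. -/
noncomputable def period (τ τ₁ : Equiv.Perm (Fin (n + k))) (τ₂ : Equiv.Perm (Fin k)) :
    Fin n ⊕ {b // IsRep τ τ₂ b} → ℕ
  | .inl a => Function.minimalPeriod τ₁ (Fin.castAdd k a)
  | .inr c => Function.minimalPeriod τ₂ c.1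

theorem period_pos (r : Fin n ⊕ {b // IsRep τ τ₂ b}) : 0 < period τ τ₁ τ₂ r := by
  cases r <;> exact Equiv.Perm.minimalPeriod_pos _ _

theorem point_injective (h : IsSplitting τ τ₁ τ₂ τ₃) {r r' : Fin n ⊕ {b // IsRep τ τ₂ b}}
    {t t' : ℕ} (ht : t < period τ τ₁ τ₂ r) (ht' : t' < period τ τ₁ τ₂ r')
    (he : point τ τ₁ τ₂ r t = point τ τ₁ τ₂ r' t') : r = r' ∧ t = t' := by
  have hlr : ∀ (a : Fin n) (c : {b // IsRep τ τ₂ b}) (t t' : ℕ),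
      τ₁^[t + 1] (Fin.castAdd k a) ≠ Fin.natAdd n (τ₂^[t'] c.1) := fun a c t t' he =>
    h.not_sameCycle_of_cycleInB (h.cycleInB_iterate c.2.1 t') a (he ▸ Equiv.Perm.sameCycle_iterate _ _ _)
  match r, r', he with
  | .inl a, .inl a', he =>
    have he : τ₁^[t + 1] (Fin.castAdd k a) = τ₁^[t' + 1] (Fin.castAdd k a') := he
    obtain rfl := h.eq_of_sameCycle_castAdd ((Equiv.Perm.sameCycle_iterate τ₁ (t + 1) _).trans
      (he ▸ (Equiv.Perm.sameCycle_iterate τ₁ (t' + 1) _).symm))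
    rw [Function.iterate_succ_apply', Function.iterate_succ_apply', τ₁.apply_eq_iff_eq] at he
    exact ⟨rfl, (Function.iterate_eq_iterate_iff_of_lt_minimalPeriod ht ht').1 he⟩
  | .inl a, .inr c, he => exact (hlr a c t t' he).elim
  | .inr c, .inl a, he => exact (hlr a c t' t he.symm).elim
  | .inr c, .inr c', he =>
    have he : τ₂^[t] c.1 = τ₂^[t'] c'.1 := Fin.natAdd_injective _ _ he
    have hs : τ₂.SameCycle c.1 c'.1 := (Equiv.Perm.sameCycle_iterate τ₂ t _).trans
      (he ▸ (Equiv.Perm.sameCycle_iterate τ₂ t' _).symm)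
    obtain rfl : c = c' := Subtype.ext (le_antisymm (c.2.2 _ hs) (c'.2.2 _ hs.symm))
    exact ⟨rfl, (Function.iterate_eq_iterate_iff_of_lt_minimalPeriod ht ht').1 he⟩

theorem point_surjective (h : IsSplitting τ τ₁ τ₂ τ₃) (i : Fin (n + k)) :
    ∃ r, ∃ t < period τ τ₁ τ₂ r, point τ τ₁ τ₂ r t = i := by
  have hA : ∀ a, τ₁.SameCycle (Fin.castAdd k a) i →
      ∃ r, ∃ t < period τ τ₁ τ₂ r, point τ τ₁ τ₂ r t = i := by
    intro a ha
    obtain ⟨i, rfl⟩ := τ₁.surjective i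
    obtain ⟨t, ht, he⟩ := Equiv.Perm.SameCycle.exists_iterate_eq (Equiv.Perm.sameCycle_apply_right.1 ha)
    refine ⟨.inl a, t, ht, ?_⟩
    change τ₁^[t + 1] (Fin.castAdd k a) = τ₁ i
    rw [Function.iterate_succ_apply', he]
  induction i using Fin.addCases with
  | left a => exact hA a (Equiv.Perm.SameCycle.refl _ _)
  | right b =>
    by_cases hb : CycleInB τ b
    · classical
      obtain ⟨c, hc, hmin⟩ := (Finset.univ.filter fun c => τ₂.SameCycle b c).exists_min_image id
        ⟨b, by simp [Equiv.Perm.SameCycle.refl]⟩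
      simp only [Finset.mem_filter_univ, id] at hc hmin
      have hcB : CycleInB τ c := by
        obtain ⟨t, -, rfl⟩ := Equiv.Perm.SameCycle.exists_iterate_eq hc
        exact h.cycleInB_iterate hb t
      obtain ⟨t, ht, he⟩ := Equiv.Perm.SameCycle.exists_iterate_eq hc.symm
      exact ⟨.inr ⟨c, hcB, fun b' hb' => hmin b' (hc.trans hb')⟩, t, ht,
        congrArg (Fin.natAdd n) he⟩
    · have hne : τ₁ (Fin.natAdd n b) ≠ Fin.natAdd n b := fun hf => hb fun a ha =>
        castAdd_ne_natAdd a b (ha.eq_of_left ((h.one_apply_of_not_inB hb).symm.trans hf)).symm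
      obtain ⟨a, ha, -⟩ := h.cycle_one _ hne
      exact hA a ha.symm

/-- These cycles partition all indices; lengths appear as `period - 1 + 1` to fit the nonempty
segments of `trace_permTensor_mul_map_eq`. -/
theorem exists_equiv (h : IsSplitting τ τ₁ τ₂ τ₃) :
    ∃ e : (Σ r, Fin (period τ τ₁ τ₂ r - 1 + 1)) ≃ Fin (n + k),
      ∀ r j, e ⟨r, j⟩ = point τ τ₁ τ₂ r j := by
  have hp : ∀ r, period τ τ₁ τ₂ r - 1 + 1 = period τ τ₁ τ₂ r := fun r =>
    Nat.sub_add_cancel (period_pos r)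
  refine ⟨Equiv.ofBijective (fun s => point τ τ₁ τ₂ s.1 s.2) ⟨?_, fun i => ?_⟩, fun r j => rfl⟩
  · rintro ⟨r, j⟩ ⟨r', j'⟩ he
    obtain ⟨hr, hj⟩ := h.point_injective (j.2.trans_eq (hp r)) (j'.2.trans_eq (hp r')) he
    subst hr
    rw [Fin.ext hj]
  · obtain ⟨r, t, ht, he⟩ := h.point_surjective i
    exact ⟨⟨r, ⟨t, (hp r).symm ▸ ht⟩⟩, he⟩

theorem perm_point_succ (h : IsSplitting τ τ₁ τ₂ τ₃) (r : Fin n ⊕ {b // IsRep τ τ₂ b}) {t : ℕ}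
    (ht : t + 1 < period τ τ₁ τ₂ r) : τ (point τ τ₁ τ₂ r t) = point τ τ₁ τ₂ r (t + 1) := by
  match r with
  | .inl a =>
    obtain ⟨b, hb, hbB⟩ := h.exists_iterate_eq_natAdd a ht
    change τ (τ₁^[t + 1] _) = τ₁^[t + 1 + 1] _
    rw [Function.iterate_succ_apply' _ (t + 1), hb, h.one_apply_of_not_inB hbB]
  | .inr c =>
    change τ (Fin.natAdd n (τ₂^[t] c.1)) = Fin.natAdd n (τ₂^[t + 1] c.1)
    rw [Function.iterate_succ_apply', h.two_of_inB _ (h.cycleInB_iterate c.2.1 t)]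

/-- The list of `a` ends at `a` itself, which `τ` sends to `τ₁ (τ₃ a)`, the head of the list of `τ₃
a`. -/
theorem perm_point_inl_last (h : IsSplitting τ τ₁ τ₂ τ₃) (a : Fin n) :
    τ (point τ τ₁ τ₂ (.inl a) (period τ τ₁ τ₂ (.inl a) - 1)) =
      point τ τ₁ τ₂ (.inl (τ₃ a)) 0 := by
  change τ (τ₁^[period τ τ₁ τ₂ (.inl a) - 1 + 1] (Fin.castAdd k a)) = _
  rw [Nat.sub_add_cancel (period_pos _)]
  exact (congrArg τ Function.iterate_minimalPeriod).trans (h.apply_castAdd a)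

theorem perm_point_inr_last (h : IsSplitting τ τ₁ τ₂ τ₃) (c : {b // IsRep τ τ₂ b}) :
    τ (point τ τ₁ τ₂ (.inr c) (period τ τ₁ τ₂ (.inr c) - 1)) = point τ τ₁ τ₂ (.inr c) 0 := by
  change τ (Fin.natAdd n (τ₂^[period τ τ₁ τ₂ (.inr c) - 1] c.1)) = Fin.natAdd n c.1
  rw [← h.two_of_inB _ (h.cycleInB_iterate c.2.1 _), ← Function.iterate_succ_apply' τ₂,
    Nat.succ_eq_add_one, Nat.sub_add_cancel (period_pos _)]
  exact congrArg _ Function.iterate_minimalPeriod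

variable {F : Type*} [Field F] {V : Type*} [AddCommGroup V] [Module F V]

theorem prod_ofFn_point_inl (h : IsSplitting τ τ₁ τ₂ τ₃) (x : Fin k → End F V)
    (y : Fin n → End F V) (a : Fin n) :
    (List.ofFn fun j : Fin (period τ τ₁ τ₂ (.inl a) - 1 + 1) =>
      Fin.append y x (point τ τ₁ τ₂ (.inl a) j)).prod = cycleMonomial τ₁ x a * y a := by
  obtain ⟨q, hq⟩ : ∃ q, period τ τ₁ τ₂ (.inl a) = q + 1 :=
    ⟨_, (Nat.sub_add_cancel (period_pos _)).symm⟩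
  have hq' : Function.minimalPeriod τ₁ (Fin.castAdd k a) = q + 1 := hq
  rw [cycleMonomial, cycleList, hq', hq, Nat.add_sub_cancel, List.ofFn_succ', List.concat_eq_append,
    List.prod_append, List.prod_singleton]
  congr 1
  · have h1 := List.ofFn_iterate τ₁ (τ₁ (Fin.castAdd k a)) (Fin.append y x) q
    refine congrArg List.prod (Eq.trans ?_ (h1.trans ?_))
    · rfl
    · change _ = (List.iterate τ₁ (τ₁ (Fin.castAdd k a)) q).map _
      refine List.map_congr_left fun i hi => ?_
      obtain ⟨t, ht, rfl⟩ := List.mem_iterate.1 hi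
      obtain ⟨b, hb, -⟩ := h.exists_iterate_eq_natAdd a (t := t) (by omega)
      rw [Function.iterate_succ_apply] at hb
      rw [hb, Fin.append_right, Fin.append_right]
  · change Fin.append y x (τ₁^[q + 1] (Fin.castAdd k a)) = y a
    rw [← hq', Function.iterate_minimalPeriod, Fin.append_left]

theorem prod_ofFn_point_inr (x : Fin k → End F V) (y : Fin n → End F V)
    (c : {b // IsRep τ τ₂ b}) :
    (List.ofFn fun j : Fin (period τ τ₁ τ₂ (.inr c) - 1 + 1) =>
      Fin.append y x (point τ τ₁ τ₂ (.inr c) j)).prod = ((cycleList τ₂ c.1).map x).prod := by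
  rw [Nat.sub_add_cancel (period_pos _)]
  change (List.ofFn fun j : Fin (Function.minimalPeriod τ₂ c.1) =>
      Fin.append y x (Fin.natAdd n (τ₂^[j] c.1))).prod = _
  simp only [Fin.append_right]
  rw [List.ofFn_iterate τ₂ c.1 x, cycleList]

theorem trace_permTensor_inv_mul_map [FiniteDimensional F V] (h : IsSplitting τ τ₁ τ₂ τ₃)
    (x : Fin k → End F V) (y : Fin n → End F V) :
    LinearMap.trace F _ (permTensor F V τ⁻¹ * PiTensorProduct.map (Fin.append y x)) =
      LinearMap.trace F _ (permTensor F V τ₃⁻¹ *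
        PiTensorProduct.map fun a => cycleMonomial τ₁ x a * y a) * cycleTraces τ τ₂ x := by
  classical
  obtain ⟨e, he⟩ := h.exists_equiv
  rw [trace_permTensor_mul_map_eq τ τ₃ _ e]
  · simp only [he, h.prod_ofFn_point_inl, prod_ofFn_point_inr]
    congr 1
    rw [cycleTraces]
    exact (Finset.prod_subtype (Finset.univ.filter (IsRep τ τ₂)) (fun b => Finset.mem_filter_univ b)
      fun b => LinearMap.trace F V ((cycleList τ₂ b).map x).prod).symm
  · intro r j
    rw [he, he]
    exact h.perm_point_succ r (by have := j.2; simp only [Fin.val_castSucc]; omega)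
  · intro a
    rw [he, he]
    exact h.perm_point_inl_last a
  · intro c
    rw [he, he]
    exact h.perm_point_inr_last c

/-- The interpretation of a permutation, in terms of its splitting. -/
theorem tensorEnd_eq_of_traceDual [FiniteDimensional F V] (h : IsSplitting τ τ₁ τ₂ τ₃)
    {H : MultilinearMap F (fun _ : Fin k => End F V) (⨂[F] _ : Fin n, End F V)}
    (hH : TraceDual H (permTensor F V τ⁻¹)) (x : Fin k → End F V) :
    tensorEnd F V n (H x) = permTensor F V τ₃⁻¹ *
      (cycleTraces τ τ₂ x • tensorEnd F V n (PiTensorProduct.tprod F (cycleMonomial τ₁ x))) := by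
  refine eq_of_trace_mul_map_eq fun y => (hH x y).trans ?_
  rw [h.trace_permTensor_inv_mul_map, tensorEnd_tprod, mul_smul_comm, smul_mul_assoc, map_smul,
    smul_eq_mul, mul_comm, mul_assoc, ← PiTensorProduct.map_mul]

end IsSplitting

end InterpretationFormula

theorem mainTheorem4 {F : Type*} [Field F] [CharZero F] {V : Type*} [AddCommGroup V] [Module F V]
    [FiniteDimensional F V] (n k : ℕ) :
    -- the identification of the equivariant maps with `End_{GL(V)}(V^{⊗(n+k)})` by the trace form
    (∃! Φ : equivariantMaps F V n k ≃ₗ[F] glEnd F V (n + k),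
      ∀ (H : equivariantMaps F V n k) (x : Fin k → Module.End F V) (y : Fin n → Module.End F V),
        LinearMap.trace F (⨂[F] _ : Fin n, V)
            (tensorEnd F V n (H.1 x) * PiTensorProduct.map y) =
          LinearMap.trace F (⨂[F] _ : Fin (n + k), V)
            ((Φ H).1 * PiTensorProduct.map (Fin.append y x))) ∧
    -- every permutation has exactly one splitting
    (∀ τ : Equiv.Perm (Fin (n + k)),
      ∃! s : Equiv.Perm (Fin (n + k)) × Equiv.Perm (Fin k) × Equiv.Perm (Fin n),
        IsSplitting τ s.1 s.2.1 s.2.2) ∧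
    -- the interpretations exist, are given by the explicit formula, and span the equivariant maps
    ∃ T : Equiv.Perm (Fin (n + k)) →
        MultilinearMap F (fun _ : Fin k => Module.End F V) (⨂[F] _ : Fin n, Module.End F V),
      (∀ τ H, IsInterpretation τ H ↔ H = T τ) ∧
      (∀ τ τ₁ τ₂ τ₃, IsSplitting τ τ₁ τ₂ τ₃ → ∀ x : Fin k → Module.End F V,
        tensorEnd F V n (T τ x) =
          permTensor F V τ₃⁻¹ *
            (cycleTraces τ τ₂ x • tensorEnd F V n (PiTensorProduct.tprod F (cycleMonomial τ₁ x)))) ∧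
      Submodule.span F (Set.range T) = equivariantMaps F V n k := by
  refine ⟨existsUnique_linearEquiv_traceDual F V n k, existsUnique_isSplitting, ?_⟩
  obtain ⟨e, he⟩ := exists_linearEquiv_traceDual F V n k
  have hT : ∀ τ : Equiv.Perm (Fin (n + k)),
      TraceDual (e.symm (permTensor F V τ⁻¹)) (permTensor F V τ⁻¹) := fun τ => by
    simpa using he (e.symm (permTensor F V τ⁻¹))
  refine ⟨fun τ => e.symm (permTensor F V τ⁻¹), fun τ H => ⟨fun h => ?_, fun h => ?_⟩,
    fun τ τ₁ τ₂ τ₃ h x => h.tensorEnd_eq_of_traceDual (hT τ) x, span_range_eq_equivariantMaps hT⟩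
  · exact TraceDual.left_unique h (hT τ)
  · exact h ▸ hT τ
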